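/- Fix $n\ge 2$, $d\ge 0$, $\alpha\in[0,1]$ and a partition of $\{1,\dots,n\}$ into $K\ge1$ disjoint folds $S_1,\dots,S_K$, each of size $m=n/K$ (an integer), and let $k(i)$ be the index of the fold containing $i$. Let $(X_1,Y_1),\dots,(X_{n+1},Y_{n+1})$ be i.i.d. random points from an arbitrary distribution $P$ on $\mathbb{R}^d\times\mathbb{R}$. Let $\mathcal{A}$ be a (measurable) regression algorithm, i.e. a map sending each finite training sample in $\mathbb{R}^d\times\mathbb{R}$ to a function $\mathbb{R}^d\to\mathbb{R}$, which is invariant under reordering of the training sample. Put $$\widehat\mu_{-S_k}=\mathcal{A}\big((X_i,Y_i): i\in\{1,\dots,n\}\setminus S_k\big),\qquad R_i^{\mathrm{CV}}=\big|Y_i-\widehat\mu_{-S_{k(i)}}(X_i)\big|,\quad i=1,\dots,n.$$ For reals $v_1,\dots,v_n$ let $\widehat q^{\,+}_{n,\alpha}\{v_i\}$ be the $\lceil(1-\alpha)(n+1)\rceil$-th smallest, and $\widehat q^{\,-}_{n,\alpha}\{v_i\}$ the $\lfloor\alpha(n+1)\rfloor$-th smallest, of $v_1,\dots,v_n$, where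 the $0$-th smallest value is $-\infty$ and the $(n+1)$-th smallest value is $+\infty$. The $K$-fold CV+ prediction interval is the set of real numbers in $$\widehat C^{\mathrm{CV+}}_{n,K,\alpha}(X_{n+1})=\Big[\widehat q^{\,-}_{n,\alpha}\big\{\widehat\mu_{-S_{k(i)}}(X_{n+1})-R_i^{\mathrm{CV}}\big\},\ \widehat q^{\,+}_{n,\alpha}\big\{\widehat\mu_{-S_{k(i)}}(X_{n+1})+R_i^{\mathrm{CV}}\big\}\Big].$$ Then: (a) $\displaystyle \mathbb{P}\big\{Y_{n+1}\in\widehat C^{\mathrm{CV+}}_{n,K,\alpha}(X_{n+1})\big\}\ \ge\ 1-2\alpha-\frac{2(1-1/K)}{n/K+1}.$ (b) $\displaystyle \mathbb{P}\big\{Y_{n+1}\in\widehat C^{\mathrm{CV+}}_{n,K,\alpha}(X_{n+1})\big\}\ \ge\ 1-2\alpha-\frac{1-K/n}{K+1}.$ Consequently, for all such $K$, $$\mathbb{P}\big\{Y_{n+1}\in\widehat C^{\mathrm{CV+}}_{n,K,\alpha}(X_{n+1})\big\}\ \ge\ 1-2\alpha-\min\Big\{\frac{2(1-1/K)}{n/K+1},\frac{1-K/n}{K+1}\Big\}\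 \ge\ 1-2\alpha-\sqrt{2/n}.$$ -/

import Mathlib

open MeasureTheory ProbabilityTheory

noncomputable section

/-- Feature space `ℝ^d`. -/
abbrev Feature (d : ℕ) : Type := EuclideanSpace ℝ (Fin d)

/-- A data point `(x, y) ∈ ℝ^d × ℝ`. -/
abbrev DataPoint (d : ℕ) : Type := Feature d × ℝ

/-- A regression algorithm: it sends a training sample of any size `m` to a fitted
regression function `ℝ^d → ℝ`. -/
abbrev RegressionAlgorithm (d : ℕ) : Type :=
  (m : ℕ) → (Fin m → DataPoint d) → Feature d → ℝ

/-- Invariance of the fitted function under reordering of the training sample. -/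
def RegressionAlgorithm.IsSymmetric {d : ℕ} (A : RegressionAlgorithm d) : Prop :=
  ∀ (m : ℕ) (z : Fin m → DataPoint d) (σ : Equiv.Perm (Fin m)), A m (z ∘ σ) = A m z

/-- At each sample size, the prediction is a jointly measurable function of the training
sample and of the point at which the fitted function is evaluated. -/
def RegressionAlgorithm.IsMeasurable {d : ℕ} (A : RegressionAlgorithm d) : Prop :=
  ∀ m : ℕ, Measurable (fun p : (Fin m → DataPoint d) × Feature d => A m p.1 p.2)

/-- The function fitted by `A` on the points `z i`, `i ∈ T` (listed by increasing index). -/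
def fitOn {d n : ℕ} (A : RegressionAlgorithm d) (z : Fin n → DataPoint d)
    (T : Finset (Fin n)) : Feature d → ℝ :=
  A T.card (fun j => z (T.orderEmbOfFin rfl j))

/-- The `k`-th smallest value (counted with multiplicity, `k = 1, …, n`) of `v 0, …, v (n-1)`,
with the conventions `-∞` for `k = 0` and `+∞` for `k > n`. -/
def kthSmallest {n : ℕ} (v : Fin n → ℝ) (k : ℕ) : EReal :=
  if k = 0 then ⊥
  else if h : k - 1 < n then ((v (Tuple.sort v ⟨k - 1, h⟩) : ℝ) : EReal)
  else ⊤

/-- Upper quantile: the `⌈(1 - α)(n + 1)⌉`-th smallest of the `n` values. -/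
def upperQuantile {n : ℕ} (α : ℝ) (v : Fin n → ℝ) : EReal :=
  kthSmallest v ⌈(1 - α) * ((n : ℝ) + 1)⌉₊

/-- Lower quantile: the `⌊α(n + 1)⌋`-th smallest of the `n` values. -/
def lowerQuantile {n : ℕ} (α : ℝ) (v : Fin n → ℝ) : EReal :=
  kthSmallest v ⌊α * ((n : ℝ) + 1)⌋₊

/-- The fold `S_k` determined by the fold-assignment map `i ↦ k(i)`. -/
def foldSet {n K : ℕ} (fold : Fin n → Fin K) (k : Fin K) : Finset (Fin n) :=
  Finset.univ.filter (fun i => fold i = k)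

/-- The regression function fitted with the `k`-th fold removed. -/
def cvFit {d n K : ℕ} (A : RegressionAlgorithm d) (fold : Fin n → Fin K)
    (z : Fin n → DataPoint d) (k : Fin K) : Feature d → ℝ :=
  fitOn A z (foldSet fold k)ᶜ

/-- The cross-validation residual of training point `i`. -/
def cvResidual {d n K : ℕ} (A : RegressionAlgorithm d) (fold : Fin n → Fin K)
    (z : Fin n → DataPoint d) (i : Fin n) : ℝ :=
  |(z i).2 - cvFit A fold z (fold i) (z i).1|

/-- The `K`-fold CV+ prediction interval at the feature `x`, with training data `z`
(as a set of reals; its endpoints may be infinite). -/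
def cvPlusInterval {d n K : ℕ} (A : RegressionAlgorithm d) (fold : Fin n → Fin K) (α : ℝ)
    (z : Fin n → DataPoint d) (x : Feature d) : Set ℝ :=
  {y : ℝ |
    lowerQuantile α (fun i => cvFit A fold z (fold i) x - cvResidual A fold z i) ≤ (y : EReal) ∧
    (y : EReal) ≤ upperQuantile α (fun i => cvFit A fold z (fold i) x + cvResidual A fold z i)}

/-- The probability that the CV+ interval built from the first `n` of the points
`(X i, Y i)`, `i = 0, …, n`, at the last feature contains the last response. -/
def cvPlusCoverage {Ω : Type*} [MeasurableSpace Ω] (Pr : Measure Ω) {d n K : ℕ}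
    (X : Fin (n + 1) → Ω → Feature d) (Y : Fin (n + 1) → Ω → ℝ)
    (A : RegressionAlgorithm d) (fold : Fin n → Fin K) (α : ℝ) : ℝ :=
  Pr.real {ω | Y (Fin.last n) ω ∈
    cvPlusInterval A fold α (fun i => (X i.castSucc ω, Y i.castSucc ω)) (X (Fin.last n) ω)}

end

/-! Give the test point a fold of its own, completed by m − 1 independent ghost points, so that
there are K + 1 exchangeable groups of size m. Two points of different groups play a match: the
model is fitted without both groups, and the strictly larger residual wins. Ghosts are held out of
every match of the test point, so these matches use exactly the CV fits, and a miss forces the test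
point to win at least (1 − α)(n + 1) of its n matches (`le_wins_of_notMem_cvPlusInterval`,
`one_sub_le_cvPlusCoverage`).

For (b), only few players can win that often (`card_many_wins_le`), and by symmetry the test point
is as likely as any other to be one of them.

For (a), the test point and fold k are m + 1 exchangeable points for a fit that uses none of them,
so the rank of the test point among them is stochastically at least uniform on 0, …, m. A miss makes
the K ranks sum to at most α(n + 1) − 1. Markov's inequality for truncated ranks bounds this,
whatever the dependence between folds (`measureReal_many_wins_le_two_mul`).

The square-root bound holds because a minimum is at most the geometric mean. -/

open MeasureTheory ProbabilityTheory

noncomputable section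

/-! ### Deterministic counting: ranks and tournaments. -/

section Combinatorics
open Finset

/-- Insert a new minimum: every earlier element lies at or above it, and the earlier ranks can only
grow. Ties only raise ranks, which `φ` tolerates. -/
theorem sum_antitone_rank_le {ι : Type*} [DecidableEq ι] (r : ι → ℝ) {φ : ℕ → ℝ}
    (hφ : Antitone φ) (B : Finset ι) :
    ∑ a ∈ B, φ #{b ∈ B | b ≠ a ∧ r a ≤ r b} ≤ ∑ j ∈ range #B, φ j := by
  induction B using Finset.induction_on_min_value r with
  | empty => simp
  | insert a s ha hmin ih =>
    rw [sum_insert ha, card_insert_of_notMem ha, sum_range_succ, add_comm]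
    refine add_le_add (le_trans (sum_le_sum fun x hx => hφ (card_le_card ?_)) ih)
      (hφ (card_le_card ?_))
    · exact filter_subset_filter _ (subset_insert _ _)
    · intro b hb
      have hne : b ≠ a := fun h => ha (h ▸ hb)
      simp [hb, hne, hmin b hb]

theorem sum_range_pos_part_le (T : ℝ) (hT : 0 ≤ T + 1) (M : ℕ) :
    ∑ j ∈ range M, max (T - j) 0 ≤ (T + 1) ^ 2 / 2 := by
  -- The subtracted square pays for the terms from `M` on, which lets the induction close.
  have key : ∀ M : ℕ, ∑ j ∈ range M, max (T - j) 0
      ≤ (T + 1) ^ 2 / 2 - (max (T + 1 - M) 0) ^ 2 / 2 := by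
    intro M
    induction M with
    | zero => simp [hT]
    | succ k ih =>
      rw [sum_range_succ]
      push_cast
      rcases le_total 0 (T - k) with h | h
      · rw [max_eq_left h, show T + 1 - ((k : ℝ) + 1) = T - k by ring, max_eq_left h]
        rw [max_eq_left (by linarith)] at ih
        nlinarith
      · rw [max_eq_right h, show T + 1 - ((k : ℝ) + 1) = T - k by ring, max_eq_right h]
        nlinarith [sq_nonneg (max (T + 1 - k) 0)]
  nlinarith [key M, sq_nonneg (max (T + 1 - M) 0)]

/-- In a tournament without matches inside groups of size at most `m`, few players win
nearly all of their `n` matches. -/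
theorem card_many_wins_le {I G : Type*} [Fintype I] [DecidableEq I] [DecidableEq G] (g : I → G)
    (W : I → I → Prop) [∀ i j, Decidable (W i j)] (hW : ∀ i j, W i j → ¬ W j i)
    (n m : ℕ) (hm : ∀ k, #{i | g i = k} ≤ m) (hn : ∀ k, #{i | g i ≠ k} ≤ n) (c : ℝ)
    (hpos : 0 ≤ m + 2 * n - 2 * c) :
    (#{i | c ≤ (#{j | g j ≠ g i ∧ W i j} : ℝ)} : ℝ) ≤ m + 2 * n - 2 * c := by
  set S : Finset I := {i | c ≤ (#{j | g j ≠ g i ∧ W i j} : ℝ)} with hS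
  rcases S.eq_empty_or_nonempty with h0 | h0
  · simpa [h0] using hpos
  have hs : (0 : ℝ) < #S := by exact_mod_cast h0.card_pos
  set w : I → I → ℝ := fun i j => if g j ≠ g i ∧ W i j then 1 else 0 with hw
  set u : I → I → ℝ := fun i j => if g j ≠ g i then 1 else 0 with hu
  have hwu : ∀ i j, w i j ≤ u i j := by
    intro i j
    simp only [hw, hu]
    split_ifs <;> simp_all
  have hww : ∀ i j, w i j + w j i ≤ u i j := by
    intro i j
    have := hW i j
    simp only [hw, hu]
    split_ifs <;> simp_all
  have hlow : c * #S ≤ ∑ i ∈ S, ∑ j, w i j := by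
    rw [mul_comm, ← nsmul_eq_mul]
    refine card_nsmul_le_sum _ _ _ fun i hi => ?_
    have := (mem_filter.1 hi).2
    simpa [hw, sum_boole] using this
  have hsplit : ∀ (f : I → I → ℝ), ∑ i ∈ S, ∑ j, f i j
      = ∑ i ∈ S, ∑ j ∈ S, f i j + ∑ i ∈ S, ∑ j ∈ Sᶜ, f i j := by
    intro f
    rw [← sum_add_distrib]
    exact sum_congr rfl fun i _ => (sum_add_sum_compl S _).symm
  -- A match has at most one winner, so inside `S` at most half of the ordered pairs are wins.
  have hin : 2 * ∑ i ∈ S, ∑ j ∈ S, w i j ≤ ∑ i ∈ S, ∑ j ∈ S, u i j := by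
    calc 2 * ∑ i ∈ S, ∑ j ∈ S, w i j
        = ∑ i ∈ S, ∑ j ∈ S, w i j + ∑ i ∈ S, ∑ j ∈ S, w j i := by
          rw [two_mul, add_right_inj, sum_comm]
      _ = ∑ i ∈ S, ∑ j ∈ S, (w i j + w j i) := by simp only [sum_add_distrib]
      _ ≤ _ := sum_le_sum fun i _ => sum_le_sum fun j _ => hww i j
  have hout : ∑ i ∈ S, ∑ j ∈ Sᶜ, w i j ≤ ∑ i ∈ S, ∑ j ∈ Sᶜ, u i j :=
    sum_le_sum fun i _ => sum_le_sum fun j _ => hwu i j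
  have hall : ∑ i ∈ S, ∑ j, u i j ≤ #S * n := by
    rw [← nsmul_eq_mul]
    refine sum_le_card_nsmul _ _ _ fun i _ => ?_
    simp only [hu, sum_boole]
    exact_mod_cast hn (g i)
  -- A large `S` must play many internal matches, since at most `m` of its members share a group.
  have hinS : #S * ((#S : ℝ) - m) ≤ ∑ i ∈ S, ∑ j ∈ S, u i j := by
    rw [← nsmul_eq_mul]
    refine card_nsmul_le_sum _ _ _ fun i _ => ?_
    simp only [hu, sum_boole]
    have h1 := card_filter_add_card_filter_not (s := S) (fun j => g j = g i)
    have h2 : #{j ∈ S | g j = g i} ≤ m :=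
      (card_le_card (filter_subset_filter _ (subset_univ _))).trans (hm (g i))
    have h3 : #S ≤ #{j ∈ S | g j ≠ g i} + m := by
      simp only [ne_eq]; omega
    have : (#S : ℝ) ≤ #{j ∈ S | g j ≠ g i} + m := by exact_mod_cast h3
    linarith
  have e1 := hsplit w
  have e2 := hsplit u
  have : (#S : ℝ) * (2 * c) ≤ #S * (2 * n - (#S - m)) := by nlinarith
  have := le_of_mul_le_mul_left this hs
  linarith

end Combinatorics

/-! ### From quantiles to counts. -/

section OrderStatistics
open Finset

theorem le_card_of_upperQuantile_lt {n : ℕ} {α : ℝ} (v : Fin n → ℝ) {y : ℝ}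
    (h : upperQuantile α v < (y : EReal)) :
    (1 - α) * ((n : ℝ) + 1) ≤ (#{i | v i < y} : ℝ) := by
  refine (Nat.le_ceil _).trans ?_
  rw [upperQuantile] at h
  set k := ⌈(1 - α) * ((n : ℝ) + 1)⌉₊
  norm_cast
  unfold kthSmallest at h
  split_ifs at h with h0 h1
  · omega
  · have hlt : v (Tuple.sort v ⟨k - 1, h1⟩) < y := by exact_mod_cast h
    have hsub : (Finset.Iic (⟨k - 1, h1⟩ : Fin n)).map (Tuple.sort v).toEmbedding
        ⊆ ({i | v i < y} : Finset (Fin n)) := by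
      intro i hi
      obtain ⟨a, ha, rfl⟩ := mem_map.1 hi
      simp only [mem_filter, mem_univ, true_and]
      exact (Tuple.monotone_sort v (mem_Iic.1 ha)).trans_lt hlt
    have := card_le_card hsub
    rw [card_map, Fin.card_Iic] at this
    simp only at this
    omega
  · exact absurd h not_top_lt

theorem le_card_of_lt_lowerQuantile {n : ℕ} {α : ℝ} (hα0 : 0 ≤ α) (hα1 : α ≤ 1) (v : Fin n → ℝ)
    {y : ℝ} (h : (y : EReal) < lowerQuantile α v) :
    (1 - α) * ((n : ℝ) + 1) ≤ (#{i | y < v i} : ℝ) := by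
  rw [lowerQuantile] at h
  have hk := Nat.floor_le (show 0 ≤ α * ((n : ℝ) + 1) by positivity)
  have hk' : ⌊α * ((n : ℝ) + 1)⌋₊ ≤ n + 1 := by
    refine Nat.floor_le_of_le ?_
    push_cast
    nlinarith
  set k := ⌊α * ((n : ℝ) + 1)⌋₊
  suffices n + 1 ≤ #{i | y < v i} + k by
    have : (n : ℝ) + 1 ≤ #{i | y < v i} + k := by exact_mod_cast this
    linarith
  unfold kthSmallest at h
  split_ifs at h with h0 h1
  · exact absurd h not_lt_bot
  · have hlt : y < v (Tuple.sort v ⟨k - 1, h1⟩) := by exact_mod_cast h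
    have hsub : (Finset.Ici (⟨k - 1, h1⟩ : Fin n)).map (Tuple.sort v).toEmbedding
        ⊆ ({i | y < v i} : Finset (Fin n)) := by
      intro i hi
      obtain ⟨a, ha, rfl⟩ := mem_map.1 hi
      simp only [mem_filter, mem_univ, true_and]
      exact hlt.trans_le (Tuple.monotone_sort v (mem_Ici.1 ha))
    have := card_le_card hsub
    rw [card_map, Fin.card_Ici] at this
    simp only at this
    omega
  -- Here the quantile is `⊤`, and `k` alone is at least `n + 1`.
  · omega

end OrderStatistics

/-! ### Symmetry of the product measure. -/

section Exchangeability

/-- Serves both to permute the points and, with `f` not surjective, to discard the ghosts. -/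
theorem map_comp_pi {I J D : Type*} [Fintype I] [Fintype J] [MeasurableSpace D]
    (P : Measure D) [IsProbabilityMeasure P] {f : I → J} (hf : Function.Injective f) :
    (Measure.pi fun _ : J => P).map (fun z : J → D => z ∘ f) = Measure.pi fun _ : I => P := by
  have h : iIndepFun (fun (j : J) (z : J → D) => z j) (Measure.pi fun _ : J => P) := by
    simpa using iIndepFun_pi (μ := fun _ : J => P) (X := fun _ x => x)
      (fun _ => aemeasurable_id)
  have h2 := h.precomp hf
  rw [iIndepFun_iff_map_fun_eq_pi_map (fun i => (measurable_pi_apply _).aemeasurable)] at h2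
  refine Eq.trans h2 ?_
  congr 1
  funext i
  exact (measurePreserving_eval (fun _ : J => P) (f i)).map_eq

theorem card_mul_integral_le {E ι : Type*} [MeasurableSpace E] (ν : Measure E)
    [IsProbabilityMeasure ν] (B : Finset ι) (F : ι → E → ℝ) (hF : ∀ a ∈ B, Integrable (F a) ν)
    (t : ι) (ht : ∀ a ∈ B, ∫ z, F a z ∂ν = ∫ z, F t z ∂ν) {C : ℝ}
    (hC : ∀ z, ∑ a ∈ B, F a z ≤ C) :
    (B.card : ℝ) * ∫ z, F t z ∂ν ≤ C := by
  rw [← nsmul_eq_mul, ← Finset.sum_const, ← Finset.sum_congr rfl ht, ← integral_finsetSum _ hF]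
  calc ∫ z, ∑ a ∈ B, F a z ∂ν ≤ ∫ _, C ∂ν :=
        integral_mono (integrable_finsetSum _ hF) (integrable_const _) hC
    _ = C := by simp

end Exchangeability

end
open MeasureTheory ProbabilityTheory

noncomputable section

/-! ### Fits, residuals and wins under reindexing. -/

section Refitting
open Finset

/-- The function fitted by `A` on the points `z i`, `i ∈ T`, listed in an arbitrary order. -/
def fitSet {d : ℕ} {I : Type*} (A : RegressionAlgorithm d) (z : I → DataPoint d)
    (T : Finset I) : Feature d → ℝ :=
  A T.card (fun j => z (T.equivFin.symm j))

/-- The absolute residual of the point `i` under the function fitted on `T`. -/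
def outRes {d : ℕ} {I : Type*} (A : RegressionAlgorithm d) (z : I → DataPoint d)
    (T : Finset I) (i : I) : ℝ :=
  |(z i).2 - fitSet A z T (z i).1|

/-- The indices outside the two groups `k` and `l`. -/
def offGroups {I G : Type*} [Fintype I] [DecidableEq G] (g : I → G) (k l : G) : Finset I :=
  {i | g i ≠ k ∧ g i ≠ l}

/-- The residual of `i` when the groups of `i` and `j` are held out. -/
def pairRes {d : ℕ} {I G : Type*} [Fintype I] [DecidableEq G] (A : RegressionAlgorithm d)
    (g : I → G) (z : I → DataPoint d) (i j : I) : ℝ :=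
  outRes A z (offGroups g (g i) (g j)) i

/-- The number of points outside the group of `i` whose held-out residual is smaller than
that of `i`. -/
def wins {d : ℕ} {I G : Type*} [Fintype I] [DecidableEq G] (A : RegressionAlgorithm d)
    (g : I → G) (z : I → DataPoint d) (i : I) : ℕ :=
  #{j | g j ≠ g i ∧ pairRes A g z j i < pairRes A g z i j}

/-- The number of other points of `B` whose residual under the function fitted on `T` is at
least that of `a`. -/
def outRank {d : ℕ} {I : Type*} [DecidableEq I] (A : RegressionAlgorithm d)
    (z : I → DataPoint d) (T B : Finset I) (a : I) : ℕ :=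
  #{b ∈ B | b ≠ a ∧ outRes A z T a ≤ outRes A z T b}

/-- Two injective enumerations of one set differ by a permutation. The lengths are kept distinct
because a set and its image have only propositionally equal cardinalities. -/
theorem RegressionAlgorithm.IsSymmetric.apply_eq_of_range_eq {d : ℕ} {A : RegressionAlgorithm d}
    (hA : A.IsSymmetric) {I : Type*} (z : I → DataPoint d) {c c' : ℕ} {e : Fin c → I}
    {e' : Fin c' → I} (he : Function.Injective e) (he' : Function.Injective e')
    (h : Set.range e = Set.range e') : A c (z ∘ e) = A c' (z ∘ e') := by
  let τ : Fin c ≃ Fin c' :=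
    (Equiv.ofInjective e he).trans ((Equiv.setCongr h).trans (Equiv.ofInjective e' he').symm)
  have hτ : ∀ j, e' (τ j) = e j := fun j => by
    have : (Equiv.ofInjective e' he') (τ j) = Equiv.setCongr h (Equiv.ofInjective e he j) := by
      simp [τ]
    simpa using congrArg Subtype.val this
  obtain rfl : c = c' := by simpa using Fintype.card_congr τ
  rw [← hA c (z ∘ e') τ]
  congr 1
  funext j
  simp [hτ]

theorem RegressionAlgorithm.IsSymmetric.fitSet_comp {d : ℕ} {A : RegressionAlgorithm d}
    (hA : A.IsSymmetric) {I J : Type*} (z : J → DataPoint d) (f : I ↪ J) (T : Finset I) :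
    fitSet A (z ∘ f) T = fitSet A z (T.map f) := by
  refine hA.apply_eq_of_range_eq z (e := fun j => f (T.equivFin.symm j))
    (e' := fun j => ((T.map f).equivFin.symm j : J)) ?_ ?_ ?_
  · exact f.injective.comp (Subtype.val_injective.comp (Equiv.injective _))
  · exact Subtype.val_injective.comp (Equiv.injective _)
  · rw [show (fun j => f (T.equivFin.symm j)) = (f ∘ Subtype.val) ∘ T.equivFin.symm from rfl,
      show (fun j => ((T.map f).equivFin.symm j : J)) = Subtype.val ∘ (T.map f).equivFin.symm
      from rfl, EquivLike.range_comp, EquivLike.range_comp, Set.range_comp]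
    ext
    simp

theorem RegressionAlgorithm.IsSymmetric.fitOn_eq {d n : ℕ} {A : RegressionAlgorithm d}
    (hA : A.IsSymmetric) (z : Fin n → DataPoint d) (T : Finset (Fin n)) :
    fitOn A z T = fitSet A z T := by
  refine hA.apply_eq_of_range_eq z (e := fun j => T.orderEmbOfFin rfl j)
    (e' := fun j => (T.equivFin.symm j : Fin n)) ?_ ?_ ?_
  · exact (T.orderEmbOfFin rfl).injective
  · exact Subtype.val_injective.comp (Equiv.injective _)
  · rw [show (fun j => (T.equivFin.symm j : Fin n)) = Subtype.val ∘ T.equivFin.symm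
      from rfl, EquivLike.range_comp]
    simp

theorem RegressionAlgorithm.IsSymmetric.outRes_comp {d : ℕ} {A : RegressionAlgorithm d}
    (hA : A.IsSymmetric) {I J : Type*} (z : J → DataPoint d) (f : I ↪ J) (T : Finset I) (i : I) :
    outRes A (z ∘ f) T i = outRes A z (T.map f) (f i) := by
  simp [outRes, hA.fitSet_comp]

theorem RegressionAlgorithm.IsSymmetric.outRank_comp {d : ℕ} {A : RegressionAlgorithm d}
    (hA : A.IsSymmetric) {I J : Type*} [DecidableEq I] [DecidableEq J] (z : J → DataPoint d)
    (f : I ↪ J) (T B : Finset I) (i : I) :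
    outRank A (z ∘ f) T B i = outRank A z (T.map f) (B.map f) (f i) := by
  rw [outRank, outRank, filter_map, card_map]
  simp only [hA.outRes_comp]
  simp

theorem offGroups_comm {I G : Type*} [Fintype I] [DecidableEq G] (g : I → G) (k l : G) :
    offGroups g k l = offGroups g l k := by
  simp [offGroups, and_comm]

/-- An embedding of index sets that respects groups and only misses points of the group of `i`
does not change the number of wins of `i`. -/
theorem RegressionAlgorithm.IsSymmetric.wins_comp {d : ℕ} {A : RegressionAlgorithm d}
    (hA : A.IsSymmetric) {I J G H : Type*} [Fintype I] [Fintype J] [DecidableEq G]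
    [DecidableEq H] (z : J → DataPoint d) (f : I ↪ J) (g : I → G) (h : J → H)
    (hfg : ∀ i j, h (f i) = h (f j) ↔ g i = g j) (i : I)
    (hmiss : ∀ j, j ∉ Set.range f → h j = h (f i)) :
    wins A g (z ∘ f) i = wins A h z (f i) := by
  have hoff : ∀ j, (offGroups g (g i) (g j)).map f = offGroups h (h (f i)) (h (f j)) := by
    intro j
    ext x
    simp only [offGroups, mem_map, mem_filter, mem_univ, true_and]
    constructor
    · rintro ⟨a, ha, rfl⟩
      simpa [hfg] using ha
    · intro hx
      -- A point missed by `f` lies in the held-out group of `i`, so it is never used for training;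
      -- below, for the same reason, it is never an opponent.
      by_cases hr : x ∈ Set.range f
      · obtain ⟨a, rfl⟩ := hr
        exact ⟨a, by simpa [hfg] using hx, rfl⟩
      · exact absurd (hmiss x hr) hx.1
  have h1 : ∀ j, pairRes A g (z ∘ f) i j = pairRes A h z (f i) (f j) := fun j => by
    rw [pairRes, pairRes, hA.outRes_comp, hoff]
  have h2 : ∀ j, pairRes A g (z ∘ f) j i = pairRes A h z (f j) (f i) := fun j => by
    rw [pairRes, pairRes, hA.outRes_comp, offGroups_comm, hoff, offGroups_comm]
  rw [wins, wins, ← card_map f]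
  congr 1
  ext x
  simp only [mem_map, mem_filter, mem_univ, true_and]
  constructor
  · rintro ⟨a, ha, rfl⟩
    simpa [hfg, h1, h2] using ha
  · intro hx
    by_cases hr : x ∈ Set.range f
    · obtain ⟨a, rfl⟩ := hr
      exact ⟨a, by simpa [hfg, h1, h2] using hx, rfl⟩
    · exact absurd (hmiss x hr) hx.1

theorem RegressionAlgorithm.IsMeasurable.outRes {d : ℕ} {A : RegressionAlgorithm d}
    (hA : A.IsMeasurable) {I : Type*} (T : Finset I) (i : I) :
    Measurable fun z : I → DataPoint d => outRes A z T i := by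
  have h1 : Measurable fun z : I → DataPoint d => fitSet A z T (z i).1 := by
    refine (hA T.card).comp (f := fun z : I → DataPoint d =>
      ((fun j => z (T.equivFin.symm j)), (z i).1)) (Measurable.prodMk ?_ ?_)
    · exact measurable_pi_lambda _ fun j => measurable_pi_apply _
    · exact (measurable_pi_apply i).fst
  have h2 : Measurable fun z : I → DataPoint d => (z i).2 := (measurable_pi_apply i).snd
  exact measurable_norm.comp (h2.sub h1)

theorem measurable_card_filter {E ι : Type*} [MeasurableSpace E] (s : Finset ι)
    (p : E → ι → Prop) [∀ z i, Decidable (p z i)]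
    (hp : ∀ i, MeasurableSet {z | p z i}) : Measurable fun z => #{i ∈ s | p z i} := by
  simp only [card_filter]
  exact Finset.measurable_sum _ fun i _ =>
    Measurable.ite (hp i) measurable_const measurable_const

theorem RegressionAlgorithm.IsMeasurable.wins {d : ℕ} {A : RegressionAlgorithm d}
    (hA : A.IsMeasurable) {I G : Type*} [Fintype I] [DecidableEq G] (g : I → G) (i : I) :
    Measurable fun z : I → DataPoint d => wins A g z i := by
  refine measurable_card_filter _ _ fun j => ?_
  exact (MeasurableSet.const _).inter (measurableSet_lt (hA.outRes _ _) (hA.outRes _ _))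

theorem RegressionAlgorithm.IsMeasurable.outRank {d : ℕ} {A : RegressionAlgorithm d}
    (hA : A.IsMeasurable) {I : Type*} [DecidableEq I] (T B : Finset I) (i : I) :
    Measurable fun z : I → DataPoint d => outRank A z T B i := by
  refine measurable_card_filter _ _ fun j => ?_
  exact (MeasurableSet.const _).inter (measurableSet_le (hA.outRes _ _) (hA.outRes _ _))

end Refitting

end
open MeasureTheory ProbabilityTheory

noncomputable section

/-! ### Two probability bounds for many wins. -/

section Bounds
open Finset

theorem integral_comp_of_injective {I D : Type*} [Fintype I] [MeasurableSpace D]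
    (P : Measure D) [IsProbabilityMeasure P] {f : I → I} (hf : Function.Injective f)
    {F : (I → D) → ℝ} (hF : Measurable F) :
    ∫ z, F (z ∘ f) ∂(Measure.pi fun _ : I => P) = ∫ z, F z ∂(Measure.pi fun _ : I => P) := by
  conv_rhs => rw [← map_comp_pi P hf]
  rw [integral_map]
  · exact (measurable_pi_lambda _ fun i => measurable_pi_apply _).aemeasurable
  · exact hF.aestronglyMeasurable

theorem measureReal_many_wins_le {d m : ℕ} {A : RegressionAlgorithm d} (hA : A.IsSymmetric)
    (hAm : A.IsMeasurable) (P : Measure (DataPoint d)) [IsProbabilityMeasure P] {G : Type*}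
    [Fintype G] [DecidableEq G] (t : G × Fin m) (n : ℕ) (hn : n + m = Fintype.card G * m)
    (c : ℝ) (hpos : 0 ≤ m + 2 * n - 2 * c) :
    ((n : ℝ) + m) * (Measure.pi fun _ : G × Fin m => P).real
      {z | c ≤ (wins A Prod.fst z t : ℝ)} ≤ m + 2 * n - 2 * c := by
  have hmeas : ∀ i : G × Fin m, MeasurableSet
      {z : G × Fin m → DataPoint d | c ≤ (wins A Prod.fst z i : ℝ)} := fun i =>
    measurableSet_le measurable_const (measurable_from_nat.comp (hAm.wins _ _))
  set F : G × Fin m → (G × Fin m → DataPoint d) → ℝ := fun i =>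
    Set.indicator {z | c ≤ (wins A Prod.fst z i : ℝ)} 1 with hF
  have hFm : ∀ i, Measurable (F i) := fun i => measurable_one.indicator (hmeas i)
  have key := card_mul_integral_le (Measure.pi fun _ : G × Fin m => P) univ F ?_ t ?_
    (C := m + 2 * n - 2 * c) ?_
  · rw [hF] at key
    simp only [integral_indicator_one (hmeas t)] at key
    rw [card_univ, Fintype.card_prod, Fintype.card_fin, ← hn] at key
    exact_mod_cast key
  · exact fun i _ => (integrable_const (1 : ℝ)).indicator (hmeas i)
  · intro i _
    -- Swapping whole groups as well as positions carries `t` to `i` while respecting the groups.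
    let π : Equiv.Perm (G × Fin m) := (Equiv.swap t.1 i.1).prodCongr (Equiv.swap t.2 i.2)
    have hπ : π t = i := by simp [π, Prod.map]
    rw [← integral_comp_of_injective P π.injective (hFm t)]
    congr 1
    funext z
    have := hA.wins_comp z π.toEmbedding Prod.fst Prod.fst (fun a b => by simp [π]) t
      (fun j hj => absurd (π.surjective j) hj)
    simp only [Equiv.coe_toEmbedding, hπ] at this
    simp [hF, Set.indicator_apply, this]
  · intro z
    simp only [hF, Set.indicator_apply, Set.mem_ofPred_eq, Pi.one_apply, sum_boole]
    have hgrp : ∀ k : G, #{i : G × Fin m | i.1 = k} = m := by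
      intro k
      rw [show ({i : G × Fin m | i.1 = k} : Finset _) = {k} ×ˢ univ by ext; simp [eq_comm, Prod.ext_iff]]
      simp
    refine card_many_wins_le (Prod.fst : G × Fin m → G)
      (fun i j => pairRes A Prod.fst z j i < pairRes A Prod.fst z i j)
      (fun i j h => h.not_gt) n m (fun k => (hgrp k).le) (fun k => ?_) c hpos
    have := card_filter_add_card_filter_not (s := (univ : Finset (G × Fin m))) (fun i => i.1 = k)
    rw [hgrp, card_univ, Fintype.card_prod, Fintype.card_fin, ← hn] at this
    simp only [ne_eq]
    omega

theorem integral_outRank_le {d : ℕ} {A : RegressionAlgorithm d} (hA : A.IsSymmetric)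
    (hAm : A.IsMeasurable) (P : Measure (DataPoint d)) [IsProbabilityMeasure P] {I : Type*}
    [Fintype I] [DecidableEq I] {T B : Finset I} (hTB : Disjoint T B) {t : I} (ht : t ∈ B)
    (x : ℝ) (hx : 0 ≤ x + 1) :
    (#B : ℝ) * ∫ z, max (x - outRank A z T B t) 0 ∂(Measure.pi fun _ : I => P)
      ≤ (x + 1) ^ 2 / 2 := by
  have hm : ∀ a, Measurable fun z : I → DataPoint d => max (x - outRank A z T B a) 0 := fun a =>
    (measurable_const.sub (measurable_from_nat.comp (hAm.outRank T B a))).max measurable_const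
  refine card_mul_integral_le (Measure.pi fun _ : I => P) B
    (fun a z => max (x - outRank A z T B a) 0) ?_ t ?_ ?_
  · intro a _
    refine Integrable.of_bound (hm a).aestronglyMeasurable |x| (ae_of_all _ fun z => ?_)
    rw [Real.norm_of_nonneg (le_max_right _ _)]
    refine max_le ?_ (abs_nonneg x)
    linarith [le_abs_self x, (Nat.cast_nonneg (outRank A z T B a) : (0 : ℝ) ≤ _)]
  · intro a ha
    rw [← integral_comp_of_injective P (Equiv.swap t a).injective (hm t)]
    congr 1
    funext z
    have h := hA.outRank_comp z (Equiv.swap t a).toEmbedding T B t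
    -- Both swapped points lie in `B`, hence outside `T`, so the fitted function is unaffected.
    have hT : T.map (Equiv.swap t a).toEmbedding = T := by
      have : ∀ j ∈ T, Equiv.swap t a j = j := fun j hj =>
        Equiv.swap_apply_of_ne_of_ne (fun e => disjoint_left.1 hTB hj (e ▸ ht))
          (fun e => disjoint_left.1 hTB hj (e ▸ ha))
      ext j
      rw [mem_map_equiv, Equiv.symm_swap]
      refine ⟨fun hj => ?_, fun hj => by rwa [this j hj]⟩
      have := this _ hj
      rw [Equiv.swap_apply_self] at this
      rwa [this]
    have hB : B.map (Equiv.swap t a).toEmbedding = B := by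
      refine eq_of_subset_of_card_le (fun j hj => ?_) (by simp)
      obtain ⟨b, hb, rfl⟩ := mem_map.1 hj
      simp only [Equiv.coe_toEmbedding, Equiv.swap_apply_def]
      split_ifs <;> assumption
    rw [hT, hB] at h
    simp only [Equiv.coe_toEmbedding, Equiv.swap_apply_left] at h
    rw [h]
  · intro z
    refine (sum_antitone_rank_le (outRes A z T) (φ := fun j => max (x - j) 0) ?_ B).trans
      (sum_range_pos_part_le x hx _)
    intro i j hij
    have : (i : ℝ) ≤ j := by exact_mod_cast hij
    exact max_le_max_right _ (by linarith)

/-- All matches against fold `k` use one common fit, so each opponent is counted either in a rank or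
in a win. -/
theorem sum_outRank_add_wins {d m K : ℕ} (A : RegressionAlgorithm d) (t : Fin m)
    (z : Option (Fin K) × Fin m → DataPoint d) :
    ∑ k : Fin K, outRank A z (offGroups Prod.fst none (some k))
        (insert (none, t) ({some k} ×ˢ univ)) (none, t)
      + wins A Prod.fst z (none, t) = K * m := by
  have h1 : ∀ k : Fin K, outRank A z (offGroups Prod.fst none (some k))
      (insert (none, t) ({some k} ×ˢ univ)) (none, t)
      = #{j : Fin m | pairRes A Prod.fst z (none, t) (some k, j)
          ≤ pairRes A Prod.fst z (some k, j) (none, t)} := by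
    intro k
    rw [outRank]
    symm
    refine card_bij (fun j _ => (some k, j)) ?_ ?_ ?_
    · intro j hj
      have := (mem_filter.1 hj).2
      rw [pairRes, pairRes, offGroups_comm _ (some k)] at this
      simp [this]
    · simp
    · rintro ⟨o, j⟩ hj
      simp only [mem_filter, mem_insert, mem_product, mem_singleton, mem_univ, and_true] at hj
      obtain ⟨h | h, hne, hle⟩ := hj
      · exact absurd h hne
      · subst h
        refine ⟨j, ?_, rfl⟩
        simpa [pairRes, offGroups_comm Prod.fst (some k)] using hle
  have h2 : wins A Prod.fst z (none, t) = ∑ k : Fin K,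
      #{j : Fin m | ¬ pairRes A Prod.fst z (none, t) (some k, j)
          ≤ pairRes A Prod.fst z (some k, j) (none, t)} := by
    simp only [wins, card_filter, Fintype.sum_prod_type, Fintype.sum_option]
    simp
  simp only [h1]
  rw [h2, ← sum_add_distrib]
  simp only [card_filter_add_card_filter_not]
  simp

theorem measureReal_many_wins_le_two_mul {d m K : ℕ} {A : RegressionAlgorithm d}
    (hA : A.IsSymmetric) (hAm : A.IsMeasurable) (P : Measure (DataPoint d))
    [IsProbabilityMeasure P] (hK : 0 < K) (t : Fin m) (c : ℝ) (hc : 0 ≤ c) :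
    (Measure.pi fun _ : Option (Fin K) × Fin m => P).real
      {z | (K * m : ℝ) - c ≤ wins A Prod.fst z (none, t)} ≤ 2 * (c + K) / (K * (m + 1)) := by
  have hK' : (0 : ℝ) < K := by exact_mod_cast hK
  -- This truncation level minimises the Markov bound K(x + 1)² / (2(m + 1)(Kx − c)); it makes Kx −
  -- c = c + K.
  set x : ℝ := 2 * (c / K) + 1 with hx
  let T : Fin K → Finset (Option (Fin K) × Fin m) := fun k => offGroups Prod.fst none (some k)
  let B : Fin K → Finset (Option (Fin K) × Fin m) := fun k =>
    insert (none, t) ({some k} ×ˢ univ)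
  let N : Fin K → (Option (Fin K) × Fin m → DataPoint d) → ℝ := fun k z =>
    outRank A z (T k) (B k) (none, t)
  have hB : ∀ k, #(B k) = m + 1 := fun k => by
    rw [card_insert_of_notMem (by simp)]
    simp
  have hint : ∀ k, ∫ z, max (x - N k z) 0 ∂(Measure.pi fun _ : Option (Fin K) × Fin m => P)
      ≤ 2 * (c / K + 1) ^ 2 / (m + 1) := by
    intro k
    have hdisj : Disjoint (T k) (B k) := by
      rw [disjoint_left]
      rintro ⟨o, j⟩ h1 h2
      simp only [T, B, offGroups, mem_filter, mem_univ, true_and, mem_insert, mem_product,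
        mem_singleton, and_true, Prod.mk.injEq] at h1 h2
      tauto
    have h := integral_outRank_le hA hAm P hdisj (t := (none, t)) (mem_insert_self _ _) x
      (by positivity)
    rw [hB] at h
    rw [le_div_iff₀ (by positivity), mul_comm]
    push_cast at h
    refine h.trans (le_of_eq ?_)
    rw [hx]
    ring
  have hNm : ∀ k, Measurable fun z => max (x - N k z) 0 := fun k =>
    (measurable_const.sub (measurable_from_nat.comp (hAm.outRank _ _ _))).max measurable_const
  have hNi : ∀ k, Integrable (fun z => max (x - N k z) 0)
      (Measure.pi fun _ : Option (Fin K) × Fin m => P) := fun k => by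
    refine Integrable.of_bound (hNm k).aestronglyMeasurable |x| (ae_of_all _ fun z => ?_)
    rw [Real.norm_of_nonneg (le_max_right _ _)]
    refine max_le ?_ (abs_nonneg x)
    linarith [le_abs_self x, (Nat.cast_nonneg _ : (0 : ℝ) ≤ N k z)]
  have hmarkov := mul_meas_ge_le_integral_of_nonneg
    (μ := Measure.pi fun _ : Option (Fin K) × Fin m => P)
    (f := fun z => ∑ k, max (x - N k z) 0)
    (ae_of_all _ fun z => sum_nonneg fun k _ => le_max_right _ _)
    (integrable_finsetSum _ fun k _ => hNi k) (c + K)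
  rw [integral_finsetSum _ fun k _ => hNi k] at hmarkov
  have hsum := sum_le_card_nsmul univ _ _ fun k _ => hint k
  rw [card_univ, Fintype.card_fin, nsmul_eq_mul] at hsum
  have hsub : {z | (K * m : ℝ) - c ≤ wins A Prod.fst z (none, t)}
      ⊆ {z | c + K ≤ ∑ k, max (x - N k z) 0} := by
    intro z hz
    have h1 : ∑ k, N k z + wins A Prod.fst z (none, t) = (K * m : ℝ) := by
      have := congrArg (Nat.cast : ℕ → ℝ) (sum_outRank_add_wins A t z)
      push_cast at this
      exact this
    have h2 : ∑ k, (x - N k z) ≤ ∑ k, max (x - N k z) 0 :=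
      sum_le_sum fun k _ => le_max_left _ _
    rw [sum_sub_distrib, sum_const, card_univ, Fintype.card_fin, nsmul_eq_mul] at h2
    have h3 : (K : ℝ) * x = 2 * c + K := by
      rw [hx]
      field_simp
    have h4 : (K * m : ℝ) - c ≤ wins A Prod.fst z (none, t) := hz
    show c + K ≤ _
    linarith
  have hle := (mul_le_mul_of_nonneg_left (measureReal_mono hsub) (by positivity)).trans
    (hmarkov.trans hsum)
  rw [← le_div_iff₀' (by positivity)] at hle
  refine hle.trans (le_of_eq ?_)
  field_simp

end Bounds

end
open MeasureTheory ProbabilityTheory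

noncomputable section

/-! ### From a miss to many wins, and the numerical slack. -/

section Coverage
open Finset

/-- A miss at either end yields (1 − α)(n + 1) indices at which the residual of the test point
exceeds the CV residual. -/
theorem le_wins_of_notMem_cvPlusInterval {d n K : ℕ} {A : RegressionAlgorithm d}
    (hA : A.IsSymmetric) (fold : Fin n → Fin K) {α : ℝ} (hα0 : 0 ≤ α) (hα1 : α ≤ 1)
    (g : Fin (n + 1) → Option (Fin K)) (hlast : g (Fin.last n) = none)
    (hcast : ∀ i, g (Fin.castSucc i) = some (fold i)) (z : Fin (n + 1) → DataPoint d)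
    (h : (z (Fin.last n)).2 ∉
      cvPlusInterval A fold α (fun i => z i.castSucc) (z (Fin.last n)).1) :
    (1 - α) * ((n : ℝ) + 1) ≤ wins A g z (Fin.last n) := by
  have hfit : ∀ k, cvFit A fold (fun i => z i.castSucc) k
      = fitSet A z (offGroups g none (some k)) := by
    intro k
    rw [cvFit, hA.fitOn_eq, show (fun i : Fin n => z i.castSucc) = z ∘ Fin.castSuccEmb from rfl,
      hA.fitSet_comp]
    congr 1
    ext j
    simp only [mem_map, mem_compl, foldSet, offGroups, mem_filter, mem_univ, true_and]
    constructor
    · rintro ⟨i, hi, rfl⟩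
      simpa [hcast] using hi
    · induction j using Fin.lastCases with
      | last => simp [hlast]
      | cast i => exact fun hi => ⟨i, by simpa [hcast] using hi, rfl⟩
  set y := (z (Fin.last n)).2 with hy
  set x := (z (Fin.last n)).1 with hx
  set R := cvResidual A fold (fun i => z i.castSucc) with hR
  set f := fun i => cvFit A fold (fun i => z i.castSucc) (fold i) x with hf
  have hcount : #{i | R i < |y - f i|} ≤ wins A g z (Fin.last n) := by
    rw [wins, ← card_map Fin.castSuccEmb]
    refine card_le_card fun j hj => ?_
    obtain ⟨i, hi, rfl⟩ := mem_map.1 hj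
    have hi := (mem_filter.1 hi).2
    simp only [mem_filter, mem_univ, true_and, Fin.castSuccEmb_apply]
    refine ⟨by simp [hcast, hlast], ?_⟩
    rw [pairRes, pairRes, hcast, hlast, offGroups_comm g (some _), outRes, outRes, ← hfit]
    exact hi
  have hcount' : (#{i | R i < |y - f i|} : ℝ) ≤ wins A g z (Fin.last n) := by
    exact_mod_cast hcount
  refine le_trans ?_ hcount'
  have hmono : ∀ p : Fin n → Prop, ∀ [DecidablePred p], (∀ i, p i → R i < |y - f i|) →
      (#{i | p i} : ℝ) ≤ #{i | R i < |y - f i|} := by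
    intro p _ hp
    exact_mod_cast card_le_card (monotone_filter_right _ fun i _ => hp i)
  rw [cvPlusInterval, Set.mem_ofPred_eq, not_and_or, not_le, not_le] at h
  obtain h | h := h
  · refine (le_card_of_lt_lowerQuantile hα0 hα1 _ h).trans (hmono _ fun i hi => ?_)
    have hi : y < f i - R i := hi
    linarith [neg_le_abs (y - f i)]
  · refine (le_card_of_upperQuantile_lt _ h).trans (hmono _ fun i hi => ?_)
    have hi : f i + R i < y := hi
    linarith [le_abs_self (y - f i)]

/-- Each fold fills its group by cardinality, so the free slots, those of the ghosts, all lie in the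
group of the test point. -/
theorem exists_embedding_folds {n K m : ℕ} (hm : n = K * m) (fold : Fin n → Fin K)
    (hfold : ∀ k : Fin K, #(foldSet fold k) = m) (t : Fin m) :
    ∃ f : Fin (n + 1) ↪ Option (Fin K) × Fin m, f (Fin.last n) = (none, t) ∧
      (∀ i : Fin n, (f i.castSucc).1 = some (fold i)) ∧ ∀ j ∉ Set.range f, j.1 = none := by
  have he : ∀ k, ∃ e : Fin n → Fin m, Set.InjOn e (foldSet fold k) := fun k => by
    refine ⟨fun i => if h : i ∈ foldSet fold k then
      (foldSet fold k).equivFinOfCardEq (hfold k) ⟨i, h⟩ else t, fun i hi j hj hij => ?_⟩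
    simpa [mem_coe.1 hi, mem_coe.1 hj] using hij
  choose e he using he
  let q : Fin n → Fin K × Fin m := fun i => (fold i, e (fold i) i)
  have hq : Function.Injective q := by
    intro i j hij
    obtain ⟨h1, h2⟩ := Prod.mk.inj hij
    rw [← h1] at h2
    exact he (fold i) (by simp [foldSet]) (by simp [foldSet, h1]) h2
  have hqs : Function.Surjective q :=
    ((Fintype.bijective_iff_injective_and_card q).2 ⟨hq, by simp [hm]⟩).2
  let f : Fin (n + 1) → Option (Fin K) × Fin m :=
    Fin.lastCases (none, t) fun i => (some (q i).1, (q i).2)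
  have hf : Function.Injective f := by
    intro i j hij
    induction i using Fin.lastCases <;> induction j using Fin.lastCases
    · rfl
    · simp [f] at hij
    · simp [f] at hij
    · simp only [f, Fin.lastCases_castSucc, Prod.mk.injEq, Option.some.injEq] at hij
      rw [hq (Prod.ext hij.1 hij.2)]
  refine ⟨⟨f, hf⟩, by simp [f], fun i => by simp [f, q], ?_⟩
  rintro ⟨o | k, j⟩ hj
  · rfl
  · obtain ⟨i, hi⟩ := hqs (k, j)
    exact absurd ⟨i.castSucc, by simp [f, hi]⟩ hj

theorem one_sub_le_cvPlusCoverage {Ω : Type*} [MeasurableSpace Ω] (Pr : Measure Ω)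
    [IsProbabilityMeasure Pr] {d n K m : ℕ} (hm : n = K * m) {α : ℝ} (hα0 : 0 ≤ α) (hα1 : α ≤ 1)
    (fold : Fin n → Fin K) (hfold : ∀ k : Fin K, #(foldSet fold k) = m)
    {A : RegressionAlgorithm d} (hA : A.IsSymmetric) (hAm : A.IsMeasurable)
    (P : Measure (DataPoint d)) [IsProbabilityMeasure P]
    {X : Fin (n + 1) → Ω → Feature d} {Y : Fin (n + 1) → Ω → ℝ}
    (hX : ∀ i, Measurable (X i)) (hY : ∀ i, Measurable (Y i))
    (hindep : iIndepFun (fun (i : Fin (n + 1)) (ω : Ω) => (X i ω, Y i ω)) Pr)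
    (hlaw : ∀ i, Pr.map (fun ω => (X i ω, Y i ω)) = P) (t : Fin m) :
    1 - (Measure.pi fun _ : Option (Fin K) × Fin m => P).real
      {z | (1 - α) * ((n : ℝ) + 1) ≤ wins A Prod.fst z (none, t)}
      ≤ cvPlusCoverage Pr X Y A fold α := by
  obtain ⟨f, hlast, hcast, hmiss⟩ := exists_embedding_folds hm fold hfold t
  set g : Fin (n + 1) → Option (Fin K) := fun i => (f i).1
  set Z : Ω → Fin (n + 1) → DataPoint d := fun ω i => (X i ω, Y i ω) with hZ
  have hZm : Measurable Z := measurable_pi_lambda _ fun i => (hX i).prodMk (hY i)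
  have hZlaw : Pr.map Z = Measure.pi fun _ => P := by
    rw [iIndepFun_iff_map_fun_eq_pi_map (fun i => ((hX i).prodMk (hY i)).aemeasurable)] at hindep
    simpa only [hlaw] using hindep
  set bad : Set (Fin (n + 1) → DataPoint d) :=
    {z | (1 - α) * ((n : ℝ) + 1) ≤ wins A g z (Fin.last n)} with hbad
  have hbadm : MeasurableSet bad :=
    measurableSet_le measurable_const (measurable_from_nat.comp (hAm.wins _ _))
  have hprob : Pr.real (Z ⁻¹' bad) = (Measure.pi fun _ : Option (Fin K) × Fin m => P).real
      {z | (1 - α) * ((n : ℝ) + 1) ≤ wins A Prod.fst z (none, t)} := by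
    have hfm : Measurable fun z : Option (Fin K) × Fin m → DataPoint d => z ∘ f :=
      measurable_pi_lambda _ fun i => measurable_pi_apply _
    rw [← map_measureReal_apply hZm hbadm, hZlaw, ← map_comp_pi P f.injective,
      map_measureReal_apply hfm hbadm]
    congr 1
    ext z
    have := hA.wins_comp z f g Prod.fst (fun _ _ => Iff.rfl) (Fin.last n)
      (fun j hj => by rw [hmiss j hj, hlast])
    rw [Set.mem_preimage, hbad, Set.mem_ofPred_eq, this, hlast]
    rfl
  -- Covering the whole space and using subadditivity avoids measurability of the coverage event.
  rw [← hprob, sub_le_iff_le_add, cvPlusCoverage, ← probReal_univ (μ := Pr)]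
  refine (measureReal_mono ?_).trans (measureReal_union_le _ _)
  intro ω _
  by_contra hω
  rw [Set.mem_union, not_or] at hω
  exact hω.2 (le_wins_of_notMem_cvPlusInterval hA fold hα0 hα1 g (by simp [g, hlast])
    (by simp [g, hcast]) (Z ω) hω.1)

theorem min_cv_slack_le_sqrt {K m : ℝ} (hK : 1 ≤ K) (hm : 1 ≤ m) :
    min (2 * (1 - 1 / K) / (K * m / K + 1)) ((1 - K / (K * m)) / (K + 1))
      ≤ √(2 / (K * m)) := by
  have hK0 : 0 < K := by linarith
  have hm0 : 0 < m := by linarith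
  have ea : 2 * (1 - 1 / K) / (K * m / K + 1) = 2 * (K - 1) / (K * (m + 1)) := by
    field_simp
  have eb : (1 - K / (K * m)) / (K + 1) = (m - 1) / (m * (K + 1)) := by
    field_simp
  rw [ea, eb]
  have ha : 0 ≤ 2 * (K - 1) / (K * (m + 1)) := by
    have := sub_nonneg.2 hK
    positivity
  have hb : 0 ≤ (m - 1) / (m * (K + 1)) := by
    have := sub_nonneg.2 hm
    positivity
  refine Real.le_sqrt_of_sq_le ?_
  rw [sq]
  -- The square of the minimum is at most the product of the two slacks.
  refine (mul_le_mul (min_le_left _ _) (min_le_right _ _) (le_min ha hb) ha).trans ?_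
  rw [div_mul_div_comm, div_le_div_iff₀ (by positivity) (by positivity)]
  have : (K - 1) * (m - 1) ≤ (K + 1) * (m + 1) := by nlinarith
  have hKm : 0 ≤ 2 * (K * m) := by positivity
  nlinarith [mul_le_mul_of_nonneg_left this hKm]

end Coverage

end

/-! ### Assembly of the coverage bounds. -/

theorem theorem4 {Ω : Type*} [MeasurableSpace Ω] (Pr : Measure Ω) [IsProbabilityMeasure Pr]
    (d n K m : ℕ) (hn : 2 ≤ n) (hm : n = K * m)
    (α : ℝ) (hα0 : 0 ≤ α) (hα1 : α ≤ 1)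
    (fold : Fin n → Fin K) (hfold : ∀ k : Fin K, (foldSet fold k).card = m)
    (A : RegressionAlgorithm d) (hAsymm : A.IsSymmetric) (hAmeas : A.IsMeasurable)
    (P : Measure (DataPoint d))
    (X : Fin (n + 1) → Ω → Feature d) (Y : Fin (n + 1) → Ω → ℝ)
    (hX : ∀ i, Measurable (X i)) (hY : ∀ i, Measurable (Y i))
    (hindep : iIndepFun (fun (i : Fin (n + 1)) (ω : Ω) => (X i ω, Y i ω)) Pr)
    (hlaw : ∀ i, Pr.map (fun ω => (X i ω, Y i ω)) = P) :
    cvPlusCoverage Pr X Y A fold α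
        ≥ 1 - 2 * α - 2 * (1 - 1 / (K : ℝ)) / ((n : ℝ) / K + 1) ∧
    cvPlusCoverage Pr X Y A fold α
        ≥ 1 - 2 * α - (1 - (K : ℝ) / n) / ((K : ℝ) + 1) ∧
    cvPlusCoverage Pr X Y A fold α
        ≥ 1 - 2 * α - min (2 * (1 - 1 / (K : ℝ)) / ((n : ℝ) / K + 1))
            ((1 - (K : ℝ) / n) / ((K : ℝ) + 1)) ∧
    1 - 2 * α - min (2 * (1 - 1 / (K : ℝ)) / ((n : ℝ) / K + 1))
            ((1 - (K : ℝ) / n) / ((K : ℝ) + 1))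
        ≥ 1 - 2 * α - Real.sqrt (2 / (n : ℝ)) ∧
    cvPlusCoverage Pr X Y A fold α ≥ 1 - 2 * α - Real.sqrt (2 / (n : ℝ)) := by

  have hK : 0 < K := Nat.pos_of_ne_zero fun h => by simp [h] at hm; omega
  have hm0 : 0 < m := Nat.pos_of_ne_zero fun h => by simp [h] at hm; omega
  have hK1 : (1 : ℝ) ≤ K := by exact_mod_cast hK
  have hm1 : (1 : ℝ) ≤ m := by exact_mod_cast hm0
  have hnR : (n : ℝ) = K * m := by exact_mod_cast hm
  have hP : IsProbabilityMeasure P := by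
    rw [← hlaw 0]
    exact Measure.isProbabilityMeasure_map ((hX 0).prodMk (hY 0)).aemeasurable
  let t : Fin m := ⟨0, hm0⟩
  have hcov := one_sub_le_cvPlusCoverage Pr hm hα0 hα1 fold hfold hAsymm hAmeas P hX hY hindep
    hlaw t
  -- Below this level of α the threshold exceeds n, the total number of matches, so the
  -- nonnegativity conditions of both bounds may be assumed elsewhere.
  have hzero : α * ((n : ℝ) + 1) - 1 < 0 → (Measure.pi fun _ : Option (Fin K) × Fin m => P).real
      {z | (1 - α) * ((n : ℝ) + 1) ≤ wins A Prod.fst z (none, t)} = 0 := by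
    intro hc
    have hempty : {z : Option (Fin K) × Fin m → DataPoint d |
        (1 - α) * ((n : ℝ) + 1) ≤ wins A Prod.fst z (none, t)} = ∅ := by
      ext z
      simp only [Set.mem_ofPred_eq, Set.mem_empty_iff_false, iff_false, not_le]
      have h := sum_outRank_add_wins A t z
      have : (wins A Prod.fst z (none, t) : ℝ) ≤ n := by
        rw [hm]
        exact_mod_cast (Nat.le_add_left _ _).trans h.le
      linarith
    rw [hempty, measureReal_empty]
  have ha : cvPlusCoverage Pr X Y A fold α
      ≥ 1 - 2 * α - 2 * (1 - 1 / (K : ℝ)) / ((n : ℝ) / K + 1) := by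
    refine ge_iff_le.2 (le_trans ?_ hcov)
    rw [sub_sub]
    refine sub_le_sub_left ?_ _
    have hslack : 2 * α + 2 * (1 - 1 / (K : ℝ)) / ((n : ℝ) / K + 1)
        = 2 * (α * (K * (m + 1)) + (K - 1)) / (K * (m + 1)) := by
      rw [hnR]
      field_simp
    rw [hslack]
    rcases le_or_gt 0 (α * ((n : ℝ) + 1) - 1) with hc | hc
    · have h := measureReal_many_wins_le_two_mul hAsymm hAmeas P hK t _ hc
      have e : (K * m : ℝ) - (α * ((n : ℝ) + 1) - 1) = (1 - α) * ((n : ℝ) + 1) := by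
        rw [hnR]
        ring
      rw [e] at h
      refine h.trans (div_le_div_of_nonneg_right ?_ (by positivity))
      rw [hnR]
      -- The loss is Km + 1 ≤ K(m + 1), multiplied by α.
      nlinarith
    · rw [hzero hc]
      have := sub_nonneg.2 hK1
      positivity
  have hb : cvPlusCoverage Pr X Y A fold α
      ≥ 1 - 2 * α - (1 - (K : ℝ) / n) / ((K : ℝ) + 1) := by
    refine ge_iff_le.2 (le_trans ?_ hcov)
    rw [sub_sub]
    refine sub_le_sub_left ?_ _
    have hslack : 2 * α + (1 - (K : ℝ) / n) / ((K : ℝ) + 1)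
        = (2 * α * (n + m) + (m - 1)) / (n + m) := by
      rw [hnR]
      field_simp
    rw [hslack, le_div_iff₀' (by positivity)]
    rcases le_or_gt 0 (α * ((n : ℝ) + 1) - 1) with hc | hc
    · have h := measureReal_many_wins_le hAsymm hAmeas P
        ((none, t) : Option (Fin K) × Fin m) n (by simp [hm, Nat.add_mul])
        ((1 - α) * ((n : ℝ) + 1)) (by linarith)
      refine h.trans ?_
      -- Compares 2α(n + 1) + m − 2 with 2α(n + m) + m − 1, using m ≥ 1.
      nlinarith
    · rw [hzero hc, mul_zero]
      have := sub_nonneg.2 hm1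
      positivity
  have hmin : min (2 * (1 - 1 / (K : ℝ)) / ((n : ℝ) / K + 1))
      ((1 - (K : ℝ) / n) / ((K : ℝ) + 1)) ≤ √(2 / (n : ℝ)) := by
    rw [hnR]
    exact min_cv_slack_le_sqrt hK1 hm1
  have hab : cvPlusCoverage Pr X Y A fold α
      ≥ 1 - 2 * α - min (2 * (1 - 1 / (K : ℝ)) / ((n : ℝ) / K + 1))
        ((1 - (K : ℝ) / n) / ((K : ℝ) + 1)) := by
    rcases min_choice (2 * (1 - 1 / (K : ℝ)) / ((n : ℝ) / K + 1))
      ((1 - (K : ℝ) / n) / ((K : ℝ) + 1)) with h | h <;> rw [h] <;> assumption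
  exact ⟨ha, hb, hab, by linarith, by linarith⟩
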